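/- Let $\Omega\subseteq\mathbb R^d$ be open; write $\omega\subset\subset\Omega$ if $\omega$ is open and its closure is compact and contained in $\Omega$. Let $\mathcal E^n(\Omega)=C^n(\Omega)$ (complex valued), $\mathcal E(\Omega)=C^\infty(\Omega)$, and let $\mathcal E'(\Omega)$ be the dual of $\mathcal E(\Omega)$, i.e. the compactly supported distributions on $\Omega$. For $T\in\mathcal E'(\Omega)$ put $\hat T(\xi)=\langle T,e^{i\xi\cdot}\rangle$. **Nets.** For a net $(f_\varepsilon)_{\varepsilon\in(0,1)}$ in $\mathcal E(\Omega)$, with $\|f\|_{W^{m,\infty}(\omega)}=\sup_{|\alpha|\le m}\|\partial^\alpha f\|_{L^\infty(\omega)}$ and $O(\cdot)$ referring to $\varepsilon\to0^+$, the net is *moderate* if for all $m\in\mathbb N_0$ and $\omega\subset\subset\Omega$ there is $a\in\mathbb R$ with $\varepsilon^{a}\|f_\varepsilon\|_{W^{m,\infty}(\omega)}=O(1)$. Put $c_{\omega}(m)=\inf\{a\in\mathbb R:\varepsilon^a\|f_\varepsilon\|_{W^{m,\infty}(\omega)}=O(1)\}\in[-\infty,\infty]$. For $k\in\mathbb N_0$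 and $s\in[-\infty,\infty)$, let $P(k,s)$ be the condition that $c_\omega(i)\le s$ for all $\omega\subset\subset\Omega$ and $0\le i\le k$, and $c_{\omega_1}(k+1)>s$ for some $\omega_1\subset\subset\Omega$. A moderate net is of class $(k,s)$ if $P(k,s)$ holds and $P(k_1,s_1)$ fails for all $k_1\in\mathbb N_0$ and $s_1<s$. It is of class $(\infty,s)$, $s\in[-\infty,\infty)$, if $s$ is the infimum of all $\tilde s\in\mathbb R$ such that $\varepsilon^{\tilde s}\|\partial^\alpha f_\varepsilon\|_{L^\infty(\omega)}=O(1)$ for all $\omega\subset\subset\Omega$ and all multi-indices $\alpha$. For $k\in\mathbb N_0$ and $s\in(-\infty,\infty]$, $\mathcal E_M^{k,s}(\Omega)$ is the set of moderate nets that are of class $(i,h)$ for some $i\in\{k,k+1,\dots\}\cup\{\infty\}$ and some $h\in[-\infty,\infty)$ with $h\le s$. **Zygmund spaces.** Let $\theta\in C_c^\infty(\mathbb R^d)$ be real valued and radial, supported in the closed unit ball, with $\theta(y)=1$ for $|y|\le\frac12$; put $\zeta(y)=-y\cdot\nabla\theta(y)$, $\varphi=\mathcal F^{-1}\theta$, $\psi=\mathcal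 F^{-1}\zeta$, where $\mathcal F^{-1}g(x)=(2\pi)^{-d}\int e^{ix\cdot y}g(y)\,dy$, and $\psi_\varepsilon=\varepsilon^{-d}\psi(\cdot/\varepsilon)$. For $r\in\mathbb R$, $C_*^r(\mathbb R^d)$ is the set of $u\in\mathcal S'(\mathbb R^d)$ with $\|\varphi*u\|_{L^\infty}+\sup_{0<\varepsilon<1}\varepsilon^{-r}\|\psi_\varepsilon*u\|_{L^\infty}<\infty$. **Theorem.** Let $k\in\mathbb N_0$, $T\in\mathcal E'(\Omega)$ and $(f_\varepsilon)_\varepsilon\in\mathcal E_M^{k,s_1}(\Omega)$ for some $s_1\in(0,\infty]$, and suppose that there is $\omega\subset\subset\Omega$ with $\operatorname{supp}T\subseteq\omega$ and $\operatorname{supp}f_\varepsilon\subseteq\omega$ for all $\varepsilon\in(0,1)$. Assume that there is $r\in\mathbb N_0$ such that $T$ extends to a continuous linear form on $\mathcal E^r(\Omega)$ and, for this extension, $$|\langle T-f_\varepsilon,\rho\rangle|=O(\varepsilon^a)\quad(\varepsilon\to0^+)\qquad\text{for all } a>0 \text{ and all } \rho\in\mathcal E^r(\Omega),$$ where $\langle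 f_\varepsilon,\rho\rangle=\int_\Omega f_\varepsilon\rho\,dx$. Then for every $\eta>0$ there is $C>0$ such that $$|\hat T(\xi)|\le C(1+|\xi|^2)^{-k/2+\eta}\qquad\text{for all }\xi\in\mathbb R^d,$$ and, for every $\eta>0$, $T\in C_*^{k-d-\eta}(\mathbb R^d)$ (for every choice of $\theta$ as above). -/

import Mathlib

open Set Filter Topology MeasureTheory TopologicalSpace
open scoped ENNReal NNReal SchwartzMap ContDiff FourierTransform

noncomputable section

namespace RegularityGF

/-- Euclidean space `ℝ^d`. -/
abbrev Euc (d : ℕ) : Type := EuclideanSpace ℝ (Fin d)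

variable {d : ℕ}

/-! ### The spaces `E^n(Ω)` of functions of class `C^n` and their duals -/

/-- `ESpace n Ω` is the space `E^n(Ω) = C^n(Ω)` of complex-valued functions of class `C^n` on the
open set `Ω`; for `n = ⊤` it is `E(Ω) = C^∞(Ω)`. An element is represented by a function on `ℝ^d`
of which only the values on `Ω` matter: everything below depends only on those values. -/
def ESpace (n : ℕ∞) (Ω : Opens (Euc d)) : Submodule ℂ (Euc d → ℂ) where
  carrier := {ρ | ContDiffOn ℝ n ρ Ω}
  add_mem' hf hg := ContDiffOn.add hf hg
  zero_mem' := contDiffOn_const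
  smul_mem' c _ hf := ContDiffOn.const_smul c hf

instance (n : ℕ∞) (Ω : Opens (Euc d)) : FunLike (ESpace n Ω) (Euc d) ℂ where
  coe f := f.1
  coe_injective := Subtype.val_injective

theorem ESpace.anti {m n : ℕ∞} (h : m ≤ n) (Ω : Opens (Euc d)) : ESpace n Ω ≤ ESpace m Ω :=
  fun _ hρ => ContDiffOn.of_le hρ (by exact_mod_cast h)

/-- The inclusion `E(Ω) ⊆ E^n(Ω)`. -/
def ESpace.incl (n : ℕ∞) (Ω : Opens (Euc d)) : ESpace ⊤ Ω →ₗ[ℂ] ESpace n Ω :=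
  Submodule.inclusion (ESpace.anti le_top Ω)

/-- The restriction to `Ω` of a globally smooth function, as an element of `E(Ω)`. -/
def ESpace.ofContDiff (Ω : Opens (Euc d)) (ρ : Euc d → ℂ) (h : ContDiff ℝ ∞ ρ) : ESpace ⊤ Ω :=
  ⟨ρ, h.contDiffOn⟩

/-- The dual of `E^n(Ω)`: linear forms on `E^n(Ω)` that are continuous for the topology of uniform
convergence on compact subsets of `Ω` of the derivatives of (finite) order at most `n`, i.e. that
satisfy a seminorm estimate `|T ρ| ≤ C sup {‖D^j ρ(x)‖ : x ∈ K, j ≤ N}` with `K ⊆ Ω` compact and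
`N ≤ n`. For `n = ⊤` this is the space `E'(Ω)` of compactly supported distributions on `Ω`. -/
structure EDual (n : ℕ∞) (Ω : Opens (Euc d)) extends ESpace n Ω →ₗ[ℂ] ℂ where
  continuous' : ∃ K : Set (Euc d), IsCompact K ∧ K ⊆ Ω ∧ ∃ N : ℕ, (N : ℕ∞) ≤ n ∧
    ∃ C : ℝ, 0 ≤ C ∧ ∀ (ρ : ESpace n Ω) (M : ℝ), 0 ≤ M →
      (∀ x ∈ K, ∀ j ≤ N, ‖iteratedFDeriv ℝ j ρ x‖ ≤ M) → ‖toFun ρ‖ ≤ C * M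

instance (n : ℕ∞) (Ω : Opens (Euc d)) : CoeFun (EDual n Ω) (fun _ => ESpace n Ω → ℂ) where
  coe T := T.toLinearMap

/-- The support of a compactly supported distribution. -/
def EDual.supp {Ω : Opens (Euc d)} (T : EDual ⊤ Ω) : Set (Euc d) :=
  Distribution.dsupport (T : ESpace ⊤ Ω → ℂ)

/-- The support, relative to `Ω`, of a function on `Ω`. -/
def suppIn (Ω : Opens (Euc d)) (f : Euc d → ℂ) : Set (Euc d) :=
  (Ω : Set (Euc d)) ∩ closure ((Ω : Set (Euc d)) ∩ Function.support f)

theorem contDiff_expChar (ξ : Euc d) :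
    ContDiff ℝ ∞ (fun x : Euc d => Complex.exp (Complex.I * ((inner ℝ ξ x : ℝ) : ℂ))) := by
  refine ContDiff.cexp (contDiff_const.mul ?_)
  exact Complex.ofRealCLM.contDiff.comp (contDiff_const.inner ℝ contDiff_id)

/-- The Fourier transform `T̂(ξ) = ⟨T, e^{i ξ·}⟩` of a compactly supported distribution. -/
def EDual.fourier {Ω : Opens (Euc d)} (T : EDual ⊤ Ω) (ξ : Euc d) : ℂ :=
  T (ESpace.ofContDiff Ω _ (contDiff_expChar ξ))

/-- The embedding `E'(Ω) → S'(ℝ^d)`, `⟨T, g⟩ = ⟨T, g|_Ω⟩`. -/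
def EDual.toTempered {Ω : Opens (Euc d)} (T : EDual ⊤ Ω) : 𝓢'(Euc d, ℂ) :=
  (SchwartzMap.mkCLMtoNormedSpace (𝕜 := ℂ) (σ := RingHom.id ℂ)
    (fun g : 𝓢(Euc d, ℂ) => T (ESpace.ofContDiff Ω g g.smooth'))
    (fun f g => T.map_add (ESpace.ofContDiff Ω f f.smooth') (ESpace.ofContDiff Ω g g.smooth'))
    (fun a f => T.map_smul a (ESpace.ofContDiff Ω f f.smooth'))
    (by
      obtain ⟨K, -, -, N, -, C, hC, hT⟩ := T.continuous'
      refine ⟨Finset.Iic (0, N), C, hC, fun f => hT _ _ (apply_nonneg _ _) fun x _ j hj => ?_⟩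
      have h1 := SchwartzMap.le_seminorm ℂ 0 j f x
      have h2 : SchwartzMap.seminorm ℂ 0 j f ≤
          ((Finset.Iic (0, N)).sup (schwartzSeminormFamily ℂ (Euc d) ℂ)) f :=
        Seminorm.le_def.1 (Finset.le_sup (f := schwartzSeminormFamily ℂ (Euc d) ℂ)
          (b := (0, j)) (by simp [hj])) f
      simp only [pow_zero, one_mul] at h1
      exact h1.trans h2) : 𝓢(Euc d, ℂ) →L[ℂ] ℂ)

theorem EDual.toTempered_apply {Ω : Opens (Euc d)} (T : EDual ⊤ Ω) (g : 𝓢(Euc d, ℂ)) :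
    T.toTempered g = T (ESpace.ofContDiff Ω g g.smooth') := rfl

/-! ### Moderate nets, calibration, and the classes `E_M^{k,s}(Ω)` -/

/-- `U ⊂⊂ Ω`: `U` is an open set whose closure is compact and contained in `Ω`. -/
def CompactlyIn (U : Set (Euc d)) (Ω : Opens (Euc d)) : Prop :=
  IsOpen U ∧ IsCompact (closure U) ∧ closure U ⊆ Ω

/-- The partial derivative `∂_{i_1} ⋯ ∂_{i_j} f (x)`. -/
def partialD {j : ℕ} (i : Fin j → Fin d) (f : Euc d → ℂ) (x : Euc d) : ℂ :=
  iteratedFDeriv ℝ j f x (fun l => EuclideanSpace.single (i l) (1 : ℝ))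

/-- `‖∂_{i_1} ⋯ ∂_{i_j} f‖_{L^∞(U)}`. -/
def supD {j : ℕ} (i : Fin j → Fin d) (U : Set (Euc d)) (f : Euc d → ℂ) : ℝ≥0∞ :=
  eLpNorm (partialD i f) ⊤ (volume.restrict U)

/-- The seminorm `‖f‖_{W^{m,∞}(U)} = sup {‖∂^α f‖_{L^∞(U)} : |α| ≤ m}`. -/
def sobolevSup (m : ℕ) (U : Set (Euc d)) (f : Euc d → ℂ) : ℝ≥0∞ :=
  ⨆ (j : ℕ) (_ : j ≤ m) (i : Fin j → Fin d), supD i U f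

/-- `ε^a N(ε) = O(1)` as `ε → 0⁺`. -/
def PowBounded (a : ℝ) (N : ℝ → ℝ≥0∞) : Prop :=
  ∃ C : ℝ≥0, ∀ᶠ ε in 𝓝[>] (0 : ℝ), ENNReal.ofReal (ε ^ a) * N ε ≤ C

/-- A net `(f_ε)_{ε ∈ (0,1)}` of smooth functions on `Ω`; values at `ε ∉ (0,1)` play no role. -/
abbrev Net (Ω : Opens (Euc d)) : Type := ℝ → ESpace ⊤ Ω

/-- The moderate nets, `E_M(Ω)`. -/
def IsModerate {Ω : Opens (Euc d)} (f : Net Ω) : Prop :=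
  ∀ (m : ℕ) (U : Set (Euc d)), CompactlyIn U Ω →
    ∃ a : ℝ, PowBounded a (fun ε => sobolevSup m U (f ε))

/-- The calibration `c_{U,m}((f_ε)_ε) = inf {a ∈ ℝ : ε^a ‖f_ε‖_{W^{m,∞}(U)} = O(1)}`, an extended
real number. -/
def calibration {Ω : Opens (Euc d)} (f : Net Ω) (U : Set (Euc d)) (m : ℕ) : EReal :=
  sInf ((fun a : ℝ => (a : EReal)) '' {a | PowBounded a (fun ε => sobolevSup m U (f ε))})

/-- `c_U(i) ≤ s` for all `U ⊂⊂ Ω` and `i ≤ k`, while `c_{U₁}(k+1) > s` for some `U₁ ⊂⊂ Ω`. -/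
def LocClass {Ω : Opens (Euc d)} (f : Net Ω) (k : ℕ) (s : EReal) : Prop :=
  (∀ U, CompactlyIn U Ω → ∀ i ≤ k, calibration f U i ≤ s) ∧
    ∃ U₁, CompactlyIn U₁ Ω ∧ s < calibration f U₁ (k + 1)

/-- The condition that a moderate net is of class `(k,s)`, for `k ∈ ℕ₀ ∪ {∞}`; for `s = ∞` no net
is of class `(k,s)`. -/
def IsOfClass {Ω : Opens (Euc d)} (f : Net Ω) : ℕ∞ → EReal → Prop
  | (k : ℕ), s => s ≠ ⊤ ∧ LocClass f k s ∧ ¬ ∃ s₁ < s, ∃ k₁ : ℕ, LocClass f k₁ s₁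
  | ⊤, s => s ≠ ⊤ ∧ s = sInf ((fun a : ℝ => (a : EReal)) '' {a | ∀ U, CompactlyIn U Ω →
      ∀ (j : ℕ) (i : Fin j → Fin d), PowBounded a (fun ε => supD i U (f ε))})

/-- The set of moderate nets of class `(k,s)`. -/
def EMTilde (Ω : Opens (Euc d)) (k : ℕ∞) (s : EReal) : Set (Net Ω) :=
  {f | IsModerate f ∧ IsOfClass f k s}

/-- `E_M^{k,s}(Ω)`, the union of the sets of moderate nets of class `(i,h)`, `i ≥ k`, `h ≤ s`. -/
def EM (Ω : Opens (Euc d)) (k : ℕ∞) (s : EReal) : Set (Net Ω) :=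
  ⋃ (h : EReal) (_ : h ≤ s) (i : ℕ∞) (_ : k ≤ i), EMTilde Ω i h

/-- There is `r ∈ ℕ` such that `T` extends to a continuous linear form `Tr` on `E^r(Ω)` (so that
`⟨T, ρ⟩` makes sense for `ρ ∈ E^r(Ω)`) and such that, for all `a > 0` and all `ρ ∈ E^r(Ω)`,
`|⟨T - f_ε, ρ⟩| = O(ε^a)` as `ε → 0⁺`. -/
def RapidlyAssociated {Ω : Opens (Euc d)} (T : EDual ⊤ Ω) (f : Net Ω) : Prop :=
  ∃ (r : ℕ) (Tr : EDual (r : ℕ∞) Ω), (∀ ρ : ESpace ⊤ Ω, Tr (ESpace.incl r Ω ρ) = T ρ) ∧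
    ∀ a : ℝ, 0 < a → ∀ ρ : ESpace (r : ℕ∞) Ω,
      (fun ε : ℝ => Tr ρ - ∫ x in (Ω : Set (Euc d)), f ε x * ρ x)
        =O[𝓝[>] 0] (fun ε : ℝ => ε ^ a)

/-! ### Zygmund spaces -/

/-- `f_ε = ε^{-d} f(·/ε)` for a Schwartz function `f`. -/
def dilate (ε : ℝ) (hε : 0 < ε) (f : 𝓢(Euc d, ℂ)) : 𝓢(Euc d, ℂ) :=
  ((ε ^ d)⁻¹ : ℝ) • SchwartzMap.compCLMOfContinuousLinearEquiv ℝ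
    (ContinuousLinearEquiv.smulLeft (Units.mk0 ε⁻¹ (inv_ne_zero hε.ne'))) f

theorem dilate_apply (ε : ℝ) (hε : 0 < ε) (f : 𝓢(Euc d, ℂ)) (x : Euc d) :
    dilate ε hε f x = ((ε ^ d)⁻¹ : ℝ) • f (ε⁻¹ • x) := rfl

/-- The Schwartz function `y ↦ f (x - y)`. -/
def reflectAt (f : 𝓢(Euc d, ℂ)) (x : Euc d) : 𝓢(Euc d, ℂ) :=
  SchwartzMap.compSubConstCLM ℝ x
    (SchwartzMap.compCLMOfContinuousLinearEquiv ℝ (ContinuousLinearEquiv.neg ℝ) f)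

theorem reflectAt_apply (f : 𝓢(Euc d, ℂ)) (x y : Euc d) : reflectAt f x y = f (x - y) := by
  change f (-(y - x)) = _
  rw [neg_sub]

/-- The convolution `(u * f)(x) = ⟨u, f(x - ·)⟩` of a tempered distribution with a Schwartz
function. -/
def conv (u : 𝓢'(Euc d, ℂ)) (f : 𝓢(Euc d, ℂ)) (x : Euc d) : ℂ := u (reflectAt f x)

/-- The inverse Fourier transform in the normalization
`(2π)^{-d} ∫ e^{i x·y} g(y) dy`; Mathlib's `𝓕⁻` has the kernel `e^{2π i x·y}`. -/
def invFourier (g : 𝓢(Euc d, ℂ)) : 𝓢(Euc d, ℂ) :=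
  dilate (2 * Real.pi) Real.two_pi_pos (𝓕⁻ g)

theorem invFourier_apply (g : 𝓢(Euc d, ℂ)) (x : Euc d) :
    invFourier g x = (((2 * Real.pi) ^ d)⁻¹ : ℝ) •
      ∫ y, Complex.exp (Complex.I * ((inner ℝ x y : ℝ) : ℂ)) * g y := by
  rw [invFourier, dilate_apply, SchwartzMap.fourierInv_coe, Real.fourierInv_eq']
  congr 1
  refine integral_congr_ae (Eventually.of_forall fun y => ?_)
  have h : 2 * Real.pi * inner ℝ y ((2 * Real.pi)⁻¹ • x) = inner ℝ x y := by
    rw [inner_smul_right, real_inner_comm, ← mul_assoc,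
      mul_inv_cancel₀ Real.two_pi_pos.ne', one_mul]
  simp only [h, smul_eq_mul, mul_comm Complex.I]

/-- A function `θ` that generates a continuous Littlewood-Paley decomposition: smooth, real valued,
radial, supported in the unit ball, and equal to `1` for `|y| ≤ 1/2`. -/
structure LPCutoff (d : ℕ) where
  toFun : Euc d → ℝ
  smooth : ContDiff ℝ ∞ toFun
  radial : ∀ x y, ‖x‖ = ‖y‖ → toFun x = toFun y
  supp : tsupport toFun ⊆ Metric.closedBall 0 1
  eq_one : ∀ y, ‖y‖ ≤ 1 / 2 → toFun y = 1

namespace LPCutoff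

variable (θ : LPCutoff d)

theorem hasCompactSupport : HasCompactSupport θ.toFun :=
  (isCompact_closedBall (0 : Euc d) 1).of_isClosed_subset (isClosed_tsupport _) θ.supp

/-- `ζ(y) = -y·∇θ(y)`. -/
def zeta (y : Euc d) : ℝ := -(fderiv ℝ θ.toFun y y)

theorem zeta_smooth : ContDiff ℝ ∞ θ.zeta :=
  ((θ.smooth.fderiv_right (m := ∞) (by simp)).clm_apply contDiff_id).neg

theorem zeta_hasCompactSupport : HasCompactSupport θ.zeta := by
  refine (θ.hasCompactSupport.fderiv (𝕜 := ℝ)).mono fun y hy => ?_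
  simp only [Function.mem_support, zeta] at hy ⊢
  intro h
  simp [h] at hy

/-- The mollifier `φ = F⁻¹ θ`. -/
def phi : 𝓢(Euc d, ℂ) :=
  invFourier ((θ.hasCompactSupport.comp_left (g := fun t : ℝ => (t : ℂ))
    Complex.ofReal_zero).toSchwartzMap (Complex.ofRealCLM.contDiff.comp θ.smooth))

/-- The wavelet `ψ = F⁻¹ ζ`. -/
def psi : 𝓢(Euc d, ℂ) :=
  invFourier ((θ.zeta_hasCompactSupport.comp_left (g := fun t : ℝ => (t : ℂ))
    Complex.ofReal_zero).toSchwartzMap (Complex.ofRealCLM.contDiff.comp θ.zeta_smooth))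

end LPCutoff

/-- The Zygmund norm `‖φ * u‖_{L^∞} + sup_{0 < ε < 1} ε^{-r} ‖ψ_ε * u‖_{L^∞}` in `[0,∞]`. -/
def zygmundNorm (θ : LPCutoff d) (r : ℝ) (u : 𝓢'(Euc d, ℂ)) : ℝ≥0∞ :=
  eLpNorm (conv u θ.phi) ⊤ volume +
    ⨆ (ε : ℝ) (hε : 0 < ε) (_ : ε < 1),
      ENNReal.ofReal (ε ^ (-r)) * eLpNorm (conv u (dilate ε hε θ.psi)) ⊤ volume

/-- The Zygmund space `C_*^r(ℝ^d)`, defined through the Littlewood-Paley decomposition of `θ`. -/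
def Zygmund (θ : LPCutoff d) (r : ℝ) : Set 𝓢'(Euc d, ℂ) := {u | zygmundNorm θ r u < ⊤}

end RegularityGF

end

noncomputable section

namespace RegularityGF

variable {d : ℕ}

/-! Write `T̂ = (T̂ - f̂_ε) + f̂_ε` and choose `ε` depending on `ξ`. The association hypothesis is
only pointwise in the test function. Banach–Steinhaus makes it uniform over exponentials, at the
price of a polynomial factor: `|T̂(ξ) - f̂_ε(ξ)| ≤ C ε^a (1+|ξ|)^r` along `ε = 2^{-(n+1)}`, with `r`
independent of `a` (`exists_bound_expElem`, `RapidlyAssociated.exists_fourier_bound`). Moderateness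
and integration by parts give `(1+|ξ|)^k |f̂_ε(ξ)| ≤ C ε^{-b}` for some `b > 0`. With `ε ≈
(1+|ξ|)^{-η/b}` the second term costs only `(1+|ξ|)^η`. Since `a` is arbitrary, it can be taken so
large that the first term is `O((1+|ξ|)^{-k})` (`RapidlyAssociated.exists_fourier_decay`).

For the Zygmund bound, a Littlewood–Paley block at scale `ε` is an integral of `T̂` over frequencies
of size about `1/ε`. Bounding it by absolute values costs the volume factor `ε^{-d}`, hence `d`
derivatives (`RapidlyAssociated.norm_conv_le`, `RapidlyAssociated.mem_zygmund`). -/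

/-- The exponential `x ↦ e^{i ξ·x}`. -/
def expChar (ξ : Euc d) (x : Euc d) : ℂ := Complex.exp (Complex.I * ((inner ℝ ξ x : ℝ) : ℂ))

theorem contDiff_expChar' (ξ : Euc d) : ContDiff ℝ ∞ (expChar ξ) := contDiff_expChar ξ

theorem norm_expChar (ξ x : Euc d) : ‖expChar ξ x‖ = 1 := by
  rw [expChar, mul_comm]
  exact Complex.norm_exp_ofReal_mul_I _

theorem iteratedDeriv_cexp_I_mul_ofReal (j : ℕ) :
    iteratedDeriv j (fun t : ℝ => Complex.exp (Complex.I * t)) =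
      fun t : ℝ => Complex.I ^ j * Complex.exp (Complex.I * t) := by
  induction j with
  | zero => simp
  | succ j ih =>
    rw [iteratedDeriv_succ, ih]
    funext t
    have h : HasDerivAt (fun t : ℝ => Complex.exp (Complex.I * t))
        (Complex.exp (Complex.I * t) * (Complex.I * 1)) t :=
      ((Complex.ofRealCLM.hasDerivAt (x := t)).const_mul Complex.I).cexp
    rw [(h.const_mul (Complex.I ^ j)).deriv]
    ring

/-- The character is `t ↦ e^{it}` composed with the linear form `⟨ξ, ·⟩` of norm `|ξ|`, so each
derivative contributes one factor `|ξ|`. -/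
theorem norm_iteratedFDeriv_expChar_le (ξ : Euc d) (j : ℕ) (x : Euc d) :
    ‖iteratedFDeriv ℝ j (expChar ξ) x‖ ≤ ‖ξ‖ ^ j := by
  have hg : ContDiff ℝ ∞ (fun t : ℝ => Complex.exp (Complex.I * t)) :=
    (contDiff_const.mul Complex.ofRealCLM.contDiff).cexp
  have h := (innerSL ℝ ξ).iteratedFDeriv_comp_right hg x (i := j) (by exact_mod_cast le_top)
  have he : (fun t : ℝ => Complex.exp (Complex.I * t)) ∘ (innerSL ℝ ξ) = expChar ξ := by
    funext y
    simp [expChar]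
  rw [he] at h
  rw [h]
  refine (ContinuousMultilinearMap.norm_compContinuousLinearMap_le _ _).trans ?_
  rw [norm_iteratedFDeriv_eq_norm_iteratedDeriv, iteratedDeriv_cexp_I_mul_ofReal]
  simp

/-! ### Superpositions of exponentials -/

/-- The superposition `∑ c_ξ (1 + |ξ|)^{-r} e^{i ξ·x}` for a summable family `c`. -/
def expSeries (r : ℕ) (c : lp (fun _ : Euc d => ℂ) 1) (x : Euc d) : ℂ :=
  ∑' ξ : Euc d, (c ξ * (((1 + ‖ξ‖) ^ r)⁻¹ : ℝ)) • expChar ξ x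

theorem summable_norm_lp_one (c : lp (fun _ : Euc d => ℂ) 1) : Summable fun ξ => ‖c ξ‖ := by
  simpa using (lp.memℓp c).summable (by simp)

theorem tsum_norm_lp_one (c : lp (fun _ : Euc d => ℂ) 1) : ∑' ξ, ‖c ξ‖ = ‖c‖ := by
  simp [lp.norm_eq_tsum_rpow (p := 1) (by simp)]

/-- The weight `(1+|ξ|)^{-r}` absorbs the growth `|ξ|^j`, which leaves a summable majorant uniform
in `x` for all orders up to `r`. -/
theorem norm_iteratedFDeriv_expSeries_term_le {r j : ℕ} (hj : j ≤ r)
    (c : lp (fun _ : Euc d => ℂ) 1) (ξ x : Euc d) :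
    ‖iteratedFDeriv ℝ j (fun x => (c ξ * (((1 + ‖ξ‖) ^ r)⁻¹ : ℝ)) • expChar ξ x) x‖ ≤ ‖c ξ‖ := by
  have h := iteratedFDeriv_const_smul_apply (𝕜 := ℝ) (x := x)
    (a := c ξ * (((1 + ‖ξ‖) ^ r)⁻¹ : ℝ))
    ((contDiff_expChar' ξ).of_le (by exact_mod_cast le_top) : ContDiff ℝ j (expChar ξ)).contDiffAt
  have h' : (fun x => (c ξ * (((1 + ‖ξ‖) ^ r)⁻¹ : ℝ)) • expChar ξ x) =
    (c ξ * (((1 + ‖ξ‖) ^ r)⁻¹ : ℝ)) • expChar ξ := rfl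
  rw [h', h, norm_smul, norm_mul, Complex.norm_real, norm_inv, norm_pow,
    Real.norm_of_nonneg (by positivity : 0 ≤ 1 + ‖ξ‖), mul_assoc]
  refine mul_le_of_le_one_right (norm_nonneg _) ?_
  rw [inv_mul_le_one₀ (by positivity)]
  calc ‖iteratedFDeriv ℝ j (expChar ξ) x‖ ≤ ‖ξ‖ ^ j := norm_iteratedFDeriv_expChar_le ξ j x
    _ ≤ (1 + ‖ξ‖) ^ j := by gcongr; linarith
    _ ≤ (1 + ‖ξ‖) ^ r := pow_le_pow_right₀ (by linarith [norm_nonneg ξ]) hj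

theorem contDiff_expSeries (r : ℕ) (c : lp (fun _ : Euc d => ℂ) 1) :
    ContDiff ℝ r (expSeries r c) :=
  contDiff_tsum (N := r) (v := fun _ ξ => ‖c ξ‖)
    (fun ξ => ((contDiff_expChar' ξ).of_le (by exact_mod_cast le_top)).const_smul _)
    (fun _ _ => summable_norm_lp_one c)
    (fun j ξ x hj => norm_iteratedFDeriv_expSeries_term_le (by exact_mod_cast hj) c ξ x)

theorem norm_iteratedFDeriv_expSeries_le {r j : ℕ} (hj : j ≤ r)
    (c : lp (fun _ : Euc d => ℂ) 1) (x : Euc d) :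
    ‖iteratedFDeriv ℝ j (expSeries r c) x‖ ≤ ‖c‖ := by
  have h := iteratedFDeriv_tsum_apply (𝕜 := ℝ) (N := r) (v := fun _ ξ => ‖c ξ‖)
    (f := fun ξ x => (c ξ * (((1 + ‖ξ‖) ^ r)⁻¹ : ℝ)) • expChar ξ x)
    (fun ξ => ((contDiff_expChar' ξ).of_le (by exact_mod_cast le_top)).const_smul _)
    (fun _ _ => summable_norm_lp_one c)
    (fun j ξ x hj => norm_iteratedFDeriv_expSeries_term_le (by exact_mod_cast hj) c ξ x)
    (k := j) (by exact_mod_cast hj) x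
  change ‖iteratedFDeriv ℝ j (fun x => ∑' ξ : Euc d,
    (c ξ * (((1 + ‖ξ‖) ^ r)⁻¹ : ℝ)) • expChar ξ x) x‖ ≤ _
  rw [h, ← tsum_norm_lp_one]
  exact tsum_of_norm_bounded (summable_norm_lp_one c).hasSum
    fun ξ => norm_iteratedFDeriv_expSeries_term_le hj c ξ x

theorem summable_expSeries (r : ℕ) (c : lp (fun _ : Euc d => ℂ) 1) (x : Euc d) :
    Summable fun ξ : Euc d => (c ξ * (((1 + ‖ξ‖) ^ r)⁻¹ : ℝ)) • expChar ξ x := by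
  refine Summable.of_norm_bounded (summable_norm_lp_one c) fun ξ => ?_
  simpa only [norm_iteratedFDeriv_zero] using
    norm_iteratedFDeriv_expSeries_term_le (Nat.zero_le r) c ξ x

/-- The map from summable families to `E^r(Ω)` given by superposition of exponentials. -/
def expSeriesMap (r : ℕ) (Ω : Opens (Euc d)) :
    lp (fun _ : Euc d => ℂ) 1 →ₗ[ℂ] ESpace (r : ℕ∞) Ω where
  toFun c := ⟨expSeries r c, (contDiff_expSeries r c).contDiffOn⟩
  map_add' c c' := by
    refine Subtype.ext (funext fun x => ?_)
    change expSeries r (c + c') x = expSeries r c x + expSeries r c' x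
    rw [expSeries, expSeries, expSeries,
      ← (summable_expSeries r c x).tsum_add (summable_expSeries r c' x)]
    refine tsum_congr fun ξ => ?_
    simp only [lp.coeFn_add, Pi.add_apply, add_mul, add_smul]
  map_smul' a c := by
    refine Subtype.ext (funext fun x => ?_)
    change expSeries r (a • c) x = a • expSeries r c x
    rw [expSeries, expSeries, ← tsum_const_smul'']
    refine tsum_congr fun ξ => ?_
    simp only [lp.coeFn_smul, Pi.smul_apply, smul_eq_mul, mul_assoc]

/-- The exponential as an element of `E^r(Ω)`. -/
def expElem (r : ℕ∞) (Ω : Opens (Euc d)) (ξ : Euc d) : ESpace r Ω :=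
  ⟨expChar ξ, ((contDiff_expChar' ξ).of_le (by exact_mod_cast le_top)).contDiffOn⟩

/-- Exponentials come from point masses of `ℓ¹` norm `(1+|ξ|)^r`; this norm is the polynomial loss
in the uniform bound. -/
theorem expSeriesMap_single (r : ℕ) (Ω : Opens (Euc d)) (ξ : Euc d) :
    expElem r Ω ξ = expSeriesMap r Ω (lp.single 1 ξ (((1 + ‖ξ‖) ^ r : ℝ) : ℂ)) := by
  refine Subtype.ext (funext fun x => ?_)
  change expChar ξ x = expSeries r _ x
  rw [expSeries, tsum_eq_single ξ]
  · have : (((1 + ‖ξ‖) ^ r : ℝ) : ℂ) ≠ 0 := by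
      rw [Complex.ofReal_ne_zero]
      positivity
    rw [lp.single_apply_self, Complex.ofReal_inv, mul_inv_cancel₀ this, one_smul]
  · intro ξ' h
    rw [lp.single_apply_ne _ _ _ h, zero_mul, zero_smul]

/-- A pointwise bounded sequence of continuous linear forms on `E^r(Ω)` grows at most like
`(1 + |ξ|)^r` on exponentials, uniformly in the sequence. -/
theorem exists_bound_expElem {r : ℕ} {Ω : Opens (Euc d)} (L : ℕ → ESpace (r : ℕ∞) Ω →ₗ[ℂ] ℂ)
    (hL : ∀ n, ∃ C : ℝ, ∀ (ρ : ESpace (r : ℕ∞) Ω) (M : ℝ), 0 ≤ M →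
      (∀ x ∈ Ω, ∀ j ≤ r, ‖iteratedFDeriv ℝ j ρ x‖ ≤ M) → ‖L n ρ‖ ≤ C * M)
    (hb : ∀ ρ, ∃ C : ℝ, ∀ n, ‖L n ρ‖ ≤ C) :
    ∃ C : ℝ, ∀ n (ξ : Euc d), ‖L n (expElem r Ω ξ)‖ ≤ C * (1 + ‖ξ‖) ^ r := by
  choose C hC using hL
  -- Pulling the forms back to the Banach space `ℓ¹` makes the uniform boundedness principle
  -- available without a topology on `E^r(Ω)`.
  let g : ℕ → lp (fun _ : Euc d => ℂ) 1 →L[ℂ] ℂ := fun n =>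
    LinearMap.mkContinuous ((L n).comp (expSeriesMap r Ω)) (C n) fun c =>
      hC n _ _ (norm_nonneg _) fun x _ j hj => norm_iteratedFDeriv_expSeries_le hj c x
  obtain ⟨C', hC'⟩ := banach_steinhaus (g := g) fun c => hb (expSeriesMap r Ω c)
  refine ⟨C', fun n ξ => ?_⟩
  rw [expSeriesMap_single]
  refine ((g n).le_of_opNorm_le (hC' n) _).trans_eq ?_
  rw [lp.norm_single (by simp), Complex.norm_real, Real.norm_of_nonneg (by positivity)]

/-! ### Decay of the Fourier transform of smooth functions of compact support -/

theorem integral_mul_expChar_eq (F : Euc d → ℂ) (ξ : Euc d) :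
    ∫ x, F x * expChar ξ x = 𝓕 F (-((2 * Real.pi)⁻¹ • ξ)) := by
  rw [Real.fourier_eq']
  refine integral_congr_ae (Eventually.of_forall fun x => ?_)
  have h : -2 * Real.pi * inner ℝ x (-((2 * Real.pi)⁻¹ • ξ)) = inner ℝ ξ x := by
    rw [inner_neg_right, inner_smul_right, real_inner_comm]
    field_simp
  simp only [h, smul_eq_mul, expChar]
  rw [mul_comm Complex.I, mul_comm (F x)]

/-- The trivial `L¹` bound and the decay from `k` derivatives are combined through `(1+|ξ|)^k ≤
2^{k-1}(1+|ξ|^k)`. -/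
theorem one_add_norm_pow_mul_integral_expChar_le (k : ℕ) {F : Euc d → ℂ} (hF : ContDiff ℝ ∞ F)
    (hc : HasCompactSupport F) (ξ : Euc d) :
    (1 + ‖ξ‖) ^ k * ‖∫ x, F x * expChar ξ x‖ ≤
      2 ^ (k - 1) * (1 + (4 * Real.pi) ^ k) *
        ∑ j ∈ Finset.range (k + 1), ∫ x, ‖iteratedFDeriv ℝ j F x‖ := by
  have hint : ∀ m n : ℕ, m ≤ (⊤ : ℕ∞) → n ≤ (⊤ : ℕ∞) →
      Integrable (fun v => ‖v‖ ^ m * ‖iteratedFDeriv ℝ n F v‖) := by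
    intro m n _ _
    refine Continuous.integrable_of_hasCompactSupport ?_ ?_
    · exact (continuous_norm.pow m).mul
        (hF.continuous_iteratedFDeriv (by exact_mod_cast le_top)).norm
    · exact (hc.iteratedFDeriv n).norm.mul_left
  set w : Euc d := -((2 * Real.pi)⁻¹ • ξ) with hw
  set S := ∑ j ∈ Finset.range (k + 1), ∫ x, ‖iteratedFDeriv ℝ j F x‖ with hS
  have h0 : ‖∫ x, F x * expChar ξ x‖ ≤ S := by
    refine (norm_integral_le_integral_norm _).trans ?_
    have h1 := Finset.single_le_sum (f := fun j => ∫ x, ‖iteratedFDeriv ℝ j F x‖)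
      (fun j _ => integral_nonneg fun x => norm_nonneg _)
      (Finset.mem_range.2 (Nat.succ_pos k))
    simpa only [norm_mul, norm_expChar, mul_one, norm_iteratedFDeriv_zero] using h1
  have hk : ‖ξ‖ ^ k * ‖∫ x, F x * expChar ξ x‖ ≤ (4 * Real.pi) ^ k * S := by
    -- In `(4π)^k`, a factor `2π` comes from `|ξ| = 2π|w|`, and a factor `2` from the constant
    -- `(2·0+2)^k` of this estimate.
    have h1 := Real.pow_mul_norm_iteratedFDeriv_fourier_le (K := ⊤) (N := ⊤) hF hint
      (k := 0) (n := k) le_top le_top w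
    simp only [norm_iteratedFDeriv_zero, pow_zero, one_mul, Nat.cast_zero, mul_zero, zero_add,
      Finset.range_one, Finset.sum_product, Finset.sum_singleton, ← hS] at h1
    rw [← integral_mul_expChar_eq] at h1
    have h2 : ‖ξ‖ = 2 * Real.pi * ‖w‖ := by
      rw [hw, norm_neg, norm_smul, Real.norm_of_nonneg (by positivity)]
      field_simp
    rw [h2, mul_pow, mul_assoc, show 4 * Real.pi = 2 * Real.pi * 2 by ring,
      mul_pow (2 * Real.pi) 2, mul_assoc]
    gcongr
  calc (1 + ‖ξ‖) ^ k * ‖∫ x, F x * expChar ξ x‖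
      ≤ 2 ^ (k - 1) * (1 ^ k + ‖ξ‖ ^ k) * ‖∫ x, F x * expChar ξ x‖ := by
        gcongr
        exact add_pow_le zero_le_one (norm_nonneg _) k
    _ = 2 ^ (k - 1) * (‖∫ x, F x * expChar ξ x‖ + ‖ξ‖ ^ k * ‖∫ x, F x * expChar ξ x‖) := by ring
    _ ≤ 2 ^ (k - 1) * (S + (4 * Real.pi) ^ k * S) := by gcongr
    _ = _ := by ring

/-! ### Bounds by partial derivatives -/

theorem norm_le_sum_norm_apply_single {j : ℕ} (A : Euc d [×j]→L[ℝ] ℂ) :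
    ‖A‖ ≤ ∑ i : Fin j → Fin d, ‖A fun l => EuclideanSpace.single (i l) (1 : ℝ)‖ := by
  refine ContinuousMultilinearMap.opNorm_le_bound (by positivity) fun m => ?_
  have hm : m = fun l => ∑ i : Fin d, m l i • EuclideanSpace.single i (1 : ℝ) := by
    funext l
    ext t
    simp [Finset.sum_apply, Pi.single_apply]
  conv_lhs => rw [hm, A.map_sum]
  rw [Finset.sum_mul]
  refine (norm_sum_le _ _).trans (Finset.sum_le_sum fun i _ => ?_)
  rw [A.map_smul_univ (fun l => m l (i l)) fun l => EuclideanSpace.single (i l) (1 : ℝ),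
    norm_smul, norm_prod, mul_comm]
  gcongr with l
  exact PiLp.norm_apply_le (m l) (i l)

/-- The factor `d^j` counts the partial derivatives of order `j`, one for each tuple of coordinate
directions. -/
theorem norm_iteratedFDeriv_le_of_sobolevSup {m : ℕ} {U : Set (Euc d)} {g : Euc d → ℂ} {M : ℝ}
    (hM : 0 ≤ M) (h : sobolevSup m U g ≤ ENNReal.ofReal M) {j : ℕ} (hj : j ≤ m) :
    ∀ᵐ x ∂volume.restrict U, ‖iteratedFDeriv ℝ j g x‖ ≤ d ^ j * M := by
  have h1 : ∀ i : Fin j → Fin d, ∀ᵐ x ∂volume.restrict U, ‖partialD i g x‖ ≤ M := by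
    intro i
    have h2 : supD i U g ≤ ENNReal.ofReal M :=
      (le_iSup₂_of_le j hj (le_iSup (fun i : Fin j → Fin d => supD i U g) i)).trans h
    rw [supD, eLpNorm_exponent_top] at h2
    filter_upwards [ae_le_eLpNormEssSup (f := partialD i g) (μ := volume.restrict U)] with x hx
    have h3 := hx.trans h2
    rwa [← ofReal_norm, ENNReal.ofReal_le_ofReal_iff hM] at h3
  filter_upwards [ae_all_iff.2 h1] with x hx
  refine (norm_le_sum_norm_apply_single _).trans ((Finset.sum_le_sum fun i _ => hx i).trans_eq ?_)
  simp

/-! ### Extension by zero -/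

section Extension

variable {Ω : Opens (Euc d)} {U : Set (Euc d)} {g : ESpace ⊤ Ω}

theorem eq_zero_of_suppIn_subset (hs : suppIn Ω g ⊆ U) {x : Euc d} (hx : x ∈ Ω) (hxU : x ∉ U) :
    g x = 0 := by
  by_contra h
  exact hxU (hs ⟨hx, subset_closure ⟨hx, h⟩⟩)

theorem indicator_eventuallyEq {x : Euc d} (hx : x ∈ Ω) :
    (Ω : Set (Euc d)).indicator g =ᶠ[𝓝 x] g := by
  filter_upwards [Ω.isOpen.mem_nhds hx] with y hy using indicator_of_mem hy _

theorem indicator_eq_zero (hs : suppIn Ω g ⊆ U) {x : Euc d} (hxU : x ∉ U) :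
    (Ω : Set (Euc d)).indicator g x = 0 := by
  by_cases hx : x ∈ (Ω : Set (Euc d))
  · rw [indicator_of_mem hx, eq_zero_of_suppIn_subset hs hx hxU]
  · exact indicator_of_notMem hx _

/-- Near a point of `closure U ⊆ Ω` the extension agrees with `g`; off `closure U` it vanishes
locally. -/
theorem contDiff_indicator (hU : CompactlyIn U Ω) (hs : suppIn Ω g ⊆ U) :
    ContDiff ℝ ∞ ((Ω : Set (Euc d)).indicator g) := by
  refine contDiff_iff_contDiffAt.2 fun x => ?_
  by_cases hx : x ∈ closure U
  · have hxΩ := hU.2.2 hx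
    exact ((g.2 : ContDiffOn ℝ ∞ g Ω).contDiffAt (Ω.isOpen.mem_nhds hxΩ)).congr_of_eventuallyEq
      (indicator_eventuallyEq hxΩ)
  · refine (contDiffAt_const (c := (0 : ℂ))).congr_of_eventuallyEq ?_
    filter_upwards [isClosed_closure.isOpen_compl.mem_nhds hx] with y hy
    exact indicator_eq_zero hs fun h => hy (subset_closure h)

theorem hasCompactSupport_indicator (hU : CompactlyIn U Ω) (hs : suppIn Ω g ⊆ U) :
    HasCompactSupport ((Ω : Set (Euc d)).indicator g) :=
  HasCompactSupport.intro hU.2.1 fun _ hx => indicator_eq_zero hs fun h => hx (subset_closure h)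

/-- A point of the closed support lies in `closure U ⊆ Ω`, hence in the support relative to `Ω`,
hence in `U` itself. All derivatives therefore vanish off `U`, the set on which the seminorms
control them. -/
theorem tsupport_indicator_subset (hU : CompactlyIn U Ω) (hs : suppIn Ω g ⊆ U) :
    tsupport ((Ω : Set (Euc d)).indicator g) ⊆ U := by
  intro x hx
  refine hs ⟨hU.2.2 (closure_mono ?_ hx), ?_⟩
  · intro y hy
    by_contra h
    exact hy (indicator_eq_zero hs h)
  · rwa [tsupport, support_indicator] at hx

theorem setIntegral_mul_eq (ρ : Euc d → ℂ) :
    ∫ x in (Ω : Set (Euc d)), g x * ρ x = ∫ x, (Ω : Set (Euc d)).indicator g x * ρ x := by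
  rw [← integral_indicator Ω.isOpen.measurableSet]
  simp only [indicator_mul_left]

theorem integrableOn_mul (hU : CompactlyIn U Ω) (hs : suppIn Ω g ⊆ U) {ρ : Euc d → ℂ}
    (hρ : ContinuousOn ρ Ω) : IntegrableOn (fun x => g x * ρ x) Ω := by
  have hg : ContinuousOn g Ω := (g.2 : ContDiffOn ℝ ∞ g Ω).continuousOn
  refine (((hg.mul hρ).mono hU.2.2).integrableOn_compact hU.2.1).of_forall_sdiff_eq_zero
    Ω.isOpen.measurableSet fun x hx => ?_
  change g x * ρ x = 0
  rw [eq_zero_of_suppIn_subset hs hx.1 fun h => hx.2 (subset_closure h), zero_mul]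

theorem integral_norm_iteratedFDeriv_indicator_le (hU : CompactlyIn U Ω) (hs : suppIn Ω g ⊆ U)
    {m : ℕ} {M : ℝ} (hM : 0 ≤ M) (h : sobolevSup m U g ≤ ENNReal.ofReal M) {j : ℕ} (hj : j ≤ m) :
    ∫ x, ‖iteratedFDeriv ℝ j ((Ω : Set (Euc d)).indicator g) x‖ ≤
      d ^ j * M * volume.real U := by
  have hzero : ∀ x ∉ U, ‖iteratedFDeriv ℝ j ((Ω : Set (Euc d)).indicator g) x‖ = 0 := by
    intro x hx
    rw [norm_eq_zero]
    by_contra h0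
    exact hx (tsupport_indicator_subset hU hs (support_iteratedFDeriv_subset j h0))
  rw [← setIntegral_eq_integral_of_forall_compl_eq_zero hzero]
  have hfin : volume U < ⊤ := (measure_mono subset_closure).trans_lt hU.2.1.measure_lt_top
  refine (Real.le_norm_self _).trans (norm_setIntegral_le_of_norm_le_const_ae hfin ?_)
  filter_upwards [norm_iteratedFDeriv_le_of_sobolevSup hM h hj,
    ae_restrict_mem hU.1.measurableSet] with x hx hxU
  have h1 : (Ω : Set (Euc d)).indicator g =ᶠ[𝓝 x] g :=
    indicator_eventuallyEq (hU.2.2 (subset_closure hxU))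
  rw [norm_norm, (h1.iteratedFDeriv ℝ j).eq_of_nhds]
  exact hx

theorem one_add_norm_pow_mul_setIntegral_expChar_le (hU : CompactlyIn U Ω)
    (hs : suppIn Ω g ⊆ U) {k : ℕ} {M : ℝ} (hM : 0 ≤ M)
    (h : sobolevSup k U g ≤ ENNReal.ofReal M) (ξ : Euc d) :
    (1 + ‖ξ‖) ^ k * ‖∫ x in (Ω : Set (Euc d)), g x * expChar ξ x‖ ≤
      2 ^ (k - 1) * (1 + (4 * Real.pi) ^ k) *
        (∑ j ∈ Finset.range (k + 1), (d : ℝ) ^ j * volume.real U) * M := by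
  rw [setIntegral_mul_eq]
  refine (one_add_norm_pow_mul_integral_expChar_le k (contDiff_indicator hU hs)
    (hasCompactSupport_indicator hU hs) ξ).trans ?_
  rw [mul_assoc _ (∑ j ∈ Finset.range (k + 1), (d : ℝ) ^ j * volume.real U), Finset.sum_mul]
  gcongr with j hj
  refine (integral_norm_iteratedFDeriv_indicator_le hU hs hM h
    (Nat.lt_succ_iff.1 (Finset.mem_range.1 hj))).trans_eq ?_
  ring

end Extension

variable {Ω : Opens (Euc d)} {U : Set (Euc d)}

/-! ### Uniform association along a dyadic sequence -/

/-- The dyadic sequence `2^{-(n+1)}` in `(0,1)`. -/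
def dyadic (n : ℕ) : ℝ := (1 / 2 : ℝ) ^ (n + 1)

theorem dyadic_pos (n : ℕ) : 0 < dyadic n := by
  rw [dyadic]
  positivity

theorem dyadic_mem (n : ℕ) : dyadic n ∈ Ioo (0 : ℝ) 1 :=
  ⟨dyadic_pos n, pow_lt_one₀ (by norm_num) (by norm_num) n.succ_ne_zero⟩

theorem tendsto_dyadic : Tendsto dyadic atTop (𝓝[>] 0) :=
  tendsto_nhdsWithin_iff.2 ⟨(tendsto_pow_atTop_nhds_zero_of_lt_one (by norm_num)
    (by norm_num : (1 / 2 : ℝ) < 1)).comp (tendsto_add_atTop_nat 1),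
    Eventually.of_forall fun n => dyadic_pos n⟩

/-- The linear form `ρ ↦ ⟨S - g, ρ⟩` on `E^r(Ω)`. -/
def diffForm (r : ℕ∞) (S : EDual r Ω) (g : ESpace ⊤ Ω) (hU : CompactlyIn U Ω)
    (hs : suppIn Ω g ⊆ U) : ESpace r Ω →ₗ[ℂ] ℂ where
  toFun ρ := S ρ - ∫ x in (Ω : Set (Euc d)), g x * ρ x
  map_add' ρ σ := by
    have h : ∫ x in (Ω : Set (Euc d)), g x * (ρ + σ) x =
        (∫ x in (Ω : Set (Euc d)), g x * ρ x) + ∫ x in (Ω : Set (Euc d)), g x * σ x := by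
      rw [← integral_add (integrableOn_mul hU hs (ρ := ⇑ρ) (ContDiffOn.continuousOn ρ.2))
        (integrableOn_mul hU hs (ρ := ⇑σ) (ContDiffOn.continuousOn σ.2))]
      exact integral_congr_ae (Eventually.of_forall fun x => mul_add _ _ _)
    rw [h, S.map_add]
    ring
  map_smul' a ρ := by
    have h : ∫ x in (Ω : Set (Euc d)), g x * (a • ρ) x =
        a * ∫ x in (Ω : Set (Euc d)), g x * ρ x := by
      rw [← integral_const_mul]
      exact integral_congr_ae (Eventually.of_forall fun x => mul_left_comm _ _ _)
    rw [h, S.map_smul, RingHom.id_apply, smul_eq_mul, smul_eq_mul]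
    ring

theorem exists_norm_diffForm_le (r : ℕ) (S : EDual (r : ℕ∞) Ω) (g : ESpace ⊤ Ω)
    (hU : CompactlyIn U Ω) (hs : suppIn Ω g ⊆ U) :
    ∃ C : ℝ, ∀ (ρ : ESpace (r : ℕ∞) Ω) (M : ℝ), 0 ≤ M →
      (∀ x ∈ Ω, ∀ j ≤ r, ‖iteratedFDeriv ℝ j ρ x‖ ≤ M) → ‖diffForm r S g hU hs ρ‖ ≤ C * M := by
  obtain ⟨K, -, hKΩ, N, hN, C, -, hC⟩ := S.continuous'
  refine ⟨C + ∫ x in (Ω : Set (Euc d)), ‖g x‖, fun ρ M hM h => ?_⟩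
  have h1 : ‖S ρ‖ ≤ C * M :=
    hC ρ M hM fun x hx j hj => h x (hKΩ hx) j (hj.trans (by exact_mod_cast hN))
  have hg : IntegrableOn (fun x => ‖g x‖) Ω := by
    have := (integrableOn_mul hU hs (ρ := fun _ => 1) continuousOn_const).norm
    simp only [mul_one] at this
    exact this
  have h2 : ‖∫ x in (Ω : Set (Euc d)), g x * ρ x‖ ≤ (∫ x in (Ω : Set (Euc d)), ‖g x‖) * M := by
    rw [← integral_mul_const]
    refine norm_integral_le_of_norm_le (hg.mul_const M) ?_
    filter_upwards [ae_restrict_mem Ω.isOpen.measurableSet] with x hx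
    rw [norm_mul]
    have := h x hx 0 (Nat.zero_le r)
    rw [norm_iteratedFDeriv_zero] at this
    gcongr
  rw [add_mul]
  exact (norm_sub_le _ _).trans (add_le_add h1 h2)

/-- By the uniform boundedness principle, rapid association is uniform on exponentials, up to a
polynomial factor. -/
theorem RapidlyAssociated.exists_fourier_bound {T : EDual ⊤ Ω} {f : Net Ω}
    (hassoc : RapidlyAssociated T f) (hU : CompactlyIn U Ω)
    (hfU : ∀ ε ∈ Ioo (0 : ℝ) 1, suppIn Ω (f ε) ⊆ U) :
    ∃ r : ℕ, ∀ a : ℝ, 0 < a → ∃ C : ℝ, 0 ≤ C ∧ ∀ n (ξ : Euc d),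
      ‖T.fourier ξ - ∫ x in (Ω : Set (Euc d)), f (dyadic n) x * expChar ξ x‖ ≤
        C * dyadic n ^ a * (1 + ‖ξ‖) ^ r := by
  obtain ⟨r, S, hS, h⟩ := hassoc
  refine ⟨r, fun a ha => ?_⟩
  -- Rescaling by `ε_n^{-a}` turns the rate `O(ε^a)` into pointwise boundedness of a sequence of
  -- forms.
  let L : ℕ → ESpace (r : ℕ∞) Ω →ₗ[ℂ] ℂ := fun n =>
    (((dyadic n ^ a)⁻¹ : ℝ) : ℂ) • diffForm r S (f (dyadic n)) hU (hfU _ (dyadic_mem n))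
  have hpos : ∀ n, 0 < dyadic n ^ a := fun n => Real.rpow_pos_of_pos (dyadic_pos n) a
  have hnorm : ∀ n ρ, ‖L n ρ‖ = (dyadic n ^ a)⁻¹ *
      ‖S ρ - ∫ x in (Ω : Set (Euc d)), f (dyadic n) x * ρ x‖ := by
    intro n ρ
    change ‖(((dyadic n ^ a)⁻¹ : ℝ) : ℂ) • (S ρ - ∫ x in (Ω : Set (Euc d)),
      f (dyadic n) x * ρ x)‖ = _
    rw [norm_smul, Complex.norm_real, Real.norm_of_nonneg (inv_nonneg.2 (hpos n).le)]
  obtain ⟨C, hC⟩ := exists_bound_expElem L (fun n => by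
    obtain ⟨C, hC⟩ := exists_norm_diffForm_le r S (f (dyadic n)) hU (hfU _ (dyadic_mem n))
    refine ⟨(dyadic n ^ a)⁻¹ * C, fun ρ M hM hρ => ?_⟩
    rw [hnorm, mul_assoc]
    have := inv_nonneg.2 (hpos n).le
    gcongr
    exact hC ρ M hM hρ) (fun ρ => by
    have h1 : (fun n => S ρ - ∫ x in (Ω : Set (Euc d)), f (dyadic n) x * ρ x)
        =O[atTop] fun n => dyadic n ^ a := (h a ha ρ).comp_tendsto tendsto_dyadic
    -- The comparison sequence never vanishes, so the eventual bound extends to all `n` with a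
    -- larger constant.
    obtain ⟨C, hC⟩ := (Asymptotics.isBigO_nat_atTop_iff
      (fun n hn => absurd hn (hpos n).ne')).1 h1
    refine ⟨C, fun n => ?_⟩
    rw [hnorm, inv_mul_le_iff₀ (hpos n), mul_comm]
    simpa only [Real.norm_of_nonneg (hpos n).le] using hC n)
  refine ⟨|C|, abs_nonneg C, fun n ξ => ?_⟩
  have h1 := hC n ξ
  rw [hnorm, inv_mul_le_iff₀ (hpos n)] at h1
  have h2 : S (expElem r Ω ξ) = T.fourier ξ := hS (ESpace.ofContDiff Ω _ (contDiff_expChar ξ))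
  rw [h2] at h1
  refine h1.trans ?_
  rw [mul_comm |C|, mul_assoc]
  have := (hpos n).le
  gcongr
  exact le_abs_self C

/-- This lets `T` be tested on Littlewood–Paley kernels through the functions `f_ε`, for which
Fubini is available. -/
theorem RapidlyAssociated.tendsto {T : EDual ⊤ Ω} {f : Net Ω}
    (hassoc : RapidlyAssociated T f) (ρ : ESpace ⊤ Ω) :
    Tendsto (fun n => ∫ x in (Ω : Set (Euc d)), f (dyadic n) x * ρ x) atTop (𝓝 (T ρ)) := by
  obtain ⟨r, S, hS, h⟩ := hassoc
  have h1 := (h 1 one_pos (ESpace.incl r Ω ρ)).comp_tendsto tendsto_dyadic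
  have h2 : Tendsto (fun n => dyadic n ^ (1 : ℝ)) atTop (𝓝 0) := by
    simpa only [Real.rpow_one] using tendsto_dyadic.mono_right nhdsWithin_le_nhds
  have h3 := (h1.trans_tendsto h2).const_sub (S (ESpace.incl r Ω ρ))
  rw [sub_zero, hS] at h3
  refine h3.congr fun n => ?_
  change T ρ - (T ρ - ∫ x in (Ω : Set (Euc d)), f (dyadic n) x * ρ x) = _
  rw [sub_sub_cancel]

/-! ### Decay of the Fourier transform -/

theorem IsModerate.exists_fourier_bound {f : Net Ω} (hf : IsModerate f) (hU : CompactlyIn U Ω)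
    (hfU : ∀ ε ∈ Ioo (0 : ℝ) 1, suppIn Ω (f ε) ⊆ U) (k : ℕ) :
    ∃ b : ℝ, 0 < b ∧ ∃ C : ℝ, 0 ≤ C ∧ ∃ n₀, ∀ n ≥ n₀, ∀ ξ : Euc d,
      (1 + ‖ξ‖) ^ k * ‖∫ x in (Ω : Set (Euc d)), f (dyadic n) x * expChar ξ x‖ ≤
        C * dyadic n ^ (-b) := by
  obtain ⟨b, C, hC⟩ := hf k U hU
  obtain ⟨n₀, hn₀⟩ := eventually_atTop.1 (tendsto_dyadic.eventually hC)
  have hV : 0 ≤ ∑ j ∈ Finset.range (k + 1), (d : ℝ) ^ j * volume.real U :=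
    Finset.sum_nonneg fun j _ => mul_nonneg (by positivity) measureReal_nonneg
  -- Raising the exponent only weakens the bound, as `ε < 1`, and makes it positive, so that one may
  -- later divide by it.
  refine ⟨max b 1, by positivity, 2 ^ (k - 1) * (1 + (4 * Real.pi) ^ k) *
    (∑ j ∈ Finset.range (k + 1), (d : ℝ) ^ j * volume.real U) * C,
    mul_nonneg (mul_nonneg (by positivity) hV) C.2, n₀,
    fun n hn ξ => ?_⟩
  have hp : 0 < dyadic n ^ b := Real.rpow_pos_of_pos (dyadic_pos n) b
  have h1 : sobolevSup k U (f (dyadic n)) ≤ ENNReal.ofReal (C * dyadic n ^ (-b)) := by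
    have h2 := hn₀ n hn
    rw [mul_comm, ← ENNReal.le_div_iff_mul_le (Or.inl (by simpa using hp))
      (Or.inl ENNReal.ofReal_ne_top)] at h2
    refine h2.trans_eq ?_
    rw [Real.rpow_neg (dyadic_pos n).le, ← div_eq_mul_inv, ENNReal.ofReal_div_of_pos hp,
      ENNReal.ofReal_coe_nnreal]
  refine (one_add_norm_pow_mul_setIntegral_expChar_le hU (hfU _ (dyadic_mem n))
    (mul_nonneg C.2 (Real.rpow_nonneg (dyadic_pos n).le _)) h1 ξ).trans ?_
  rw [← mul_assoc]
  refine mul_le_mul_of_nonneg_left ?_ (mul_nonneg (mul_nonneg (by positivity) hV) C.2)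
  exact Real.rpow_le_rpow_of_exponent_ge (dyadic_pos n) (dyadic_mem n).2.le
    (neg_le_neg (le_max_left b 1))

/-- If `2^{-(m+1)} < x ≤ 2^{-m}`, then `n = n₀ + m` works: forcing the index past `n₀` costs only a
fixed factor. -/
theorem exists_dyadic_near (n₀ : ℕ) {x : ℝ} (hx : 0 < x) (hx1 : x ≤ 1) :
    ∃ n ≥ n₀, dyadic n₀ * x ≤ dyadic n ∧ dyadic n ≤ x := by
  obtain ⟨m, hm, hm'⟩ := exists_nat_pow_near_of_lt_one hx hx1 (y := (1 / 2 : ℝ)) (by norm_num)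
    (by norm_num)
  refine ⟨n₀ + m, Nat.le_add_right _ _, ?_, ?_⟩
  · have h : dyadic (n₀ + m) = dyadic n₀ * (1 / 2) ^ m := by
      rw [dyadic, dyadic, ← pow_add]
      ring_nf
    rw [h]
    exact mul_le_mul_of_nonneg_left hm' (dyadic_pos n₀).le
  · refine le_trans ?_ hm.le
    exact pow_le_pow_of_le_one (by norm_num) (by norm_num) (by omega)

/-- The Fourier transform of a distribution that is rapidly associated to a moderate net. -/
theorem RapidlyAssociated.exists_fourier_decay {T : EDual ⊤ Ω} {f : Net Ω}
    (hassoc : RapidlyAssociated T f) (hf : IsModerate f) (hU : CompactlyIn U Ω)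
    (hfU : ∀ ε ∈ Ioo (0 : ℝ) 1, suppIn Ω (f ε) ⊆ U) (k : ℕ) {η : ℝ} (hη : 0 < η) :
    ∃ C : ℝ, 0 ≤ C ∧ ∀ ξ : Euc d, (1 + ‖ξ‖) ^ k * ‖T.fourier ξ‖ ≤ C * (1 + ‖ξ‖) ^ η := by
  obtain ⟨r, hr⟩ := hassoc.exists_fourier_bound hU hfU
  obtain ⟨b, hb, C, hC, n₀, hn₀⟩ := hf.exists_fourier_bound hU hfU k
  -- For `ε ≤ R^{-η/b}` this exponent gives `ε^a ≤ R^{-(r+k)}`, which cancels the loss `R^r` and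
  -- leaves `R^{-k}`. The `+ 1` keeps it positive when `r = k = 0`.
  obtain ⟨C', hC', hT⟩ := hr ((r + k) * b / η + 1) (by positivity)
  refine ⟨C' + C * dyadic n₀ ^ (-b), add_nonneg hC' (mul_nonneg hC
    (Real.rpow_nonneg (dyadic_pos _).le _)), fun ξ => ?_⟩
  set R : ℝ := 1 + ‖ξ‖ with hR
  have hR1 : 1 ≤ R := le_add_of_nonneg_right (norm_nonneg ξ)
  have hR0 : 0 < R := one_pos.trans_le hR1
  have hx0 : 0 < R ^ (-(η / b)) := Real.rpow_pos_of_pos hR0 _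
  have hx1 : R ^ (-(η / b)) ≤ 1 :=
    Real.rpow_le_one_of_one_le_of_nonpos hR1 (neg_nonpos.2 (by positivity))
  -- The upper bound on `ε` controls `ε^a`; the lower bound controls `ε^{-b}` by a multiple of
  -- `R^η`.
  obtain ⟨n, hn, h1, h2⟩ := exists_dyadic_near n₀ hx0 hx1
  have h3 : dyadic n ^ ((r + k) * b / η + 1) ≤ (R ^ (r + k))⁻¹ := by
    calc dyadic n ^ ((r + k) * b / η + 1)
        ≤ dyadic n ^ ((r + k) * b / η) :=
          Real.rpow_le_rpow_of_exponent_ge (dyadic_pos n) (dyadic_mem n).2.le (by linarith)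
      _ ≤ (R ^ (-(η / b))) ^ ((r + k) * b / η) :=
          Real.rpow_le_rpow (dyadic_pos n).le h2 (by positivity)
      _ = (R ^ (r + k))⁻¹ := by
          rw [← Real.rpow_mul hR0.le, ← Real.rpow_natCast, ← Real.rpow_neg hR0.le]
          congr 1
          push_cast
          field_simp
  have h4 : dyadic n ^ (-b) ≤ dyadic n₀ ^ (-b) * R ^ η := by
    calc dyadic n ^ (-b) ≤ (dyadic n₀ * R ^ (-(η / b))) ^ (-b) :=
          Real.rpow_le_rpow_of_nonpos (mul_pos (dyadic_pos _) hx0) h1 (by linarith)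
      _ = dyadic n₀ ^ (-b) * R ^ η := by
          rw [Real.mul_rpow (dyadic_pos _).le hx0.le, ← Real.rpow_mul hR0.le]
          congr 2
          field_simp
  have h5 : ‖T.fourier ξ‖ ≤ C' * (R ^ (r + k))⁻¹ * R ^ r +
      ‖∫ x in (Ω : Set (Euc d)), f (dyadic n) x * expChar ξ x‖ := by
    refine (norm_le_norm_sub_add _ _).trans (add_le_add ((hT n ξ).trans ?_) le_rfl)
    gcongr
  calc R ^ k * ‖T.fourier ξ‖ ≤ R ^ k * (C' * (R ^ (r + k))⁻¹ * R ^ r) +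
        R ^ k * ‖∫ x in (Ω : Set (Euc d)), f (dyadic n) x * expChar ξ x‖ := by
        rw [← mul_add]
        gcongr
    _ ≤ C' * R ^ η + C * (dyadic n₀ ^ (-b) * R ^ η) := by
        gcongr ?_ + ?_
        · have : R ^ k * (C' * (R ^ (r + k))⁻¹ * R ^ r) = C' * 1 := by
            rw [pow_add]
            field_simp
          rw [this]
          gcongr
          exact Real.one_le_rpow hR1 hη.le
        · exact (hn₀ n hn ξ).trans (mul_le_mul_of_nonneg_left h4 hC)
    _ = _ := by ring

theorem exists_norm_fourier_le {T : EDual ⊤ Ω} {f : Net Ω}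
    (hassoc : RapidlyAssociated T f) (hf : IsModerate f) (hU : CompactlyIn U Ω)
    (hfU : ∀ ε ∈ Ioo (0 : ℝ) 1, suppIn Ω (f ε) ⊆ U) (k : ℕ) {η : ℝ} (hη : 0 < η) :
    ∃ C : ℝ, 0 < C ∧ ∀ ξ : Euc d, ‖T.fourier ξ‖ ≤ C * (1 + ‖ξ‖ ^ 2) ^ (-(k : ℝ) / 2 + η) := by
  -- The loss is taken to be `2η` because `(1+|ξ|)^{2η}` is comparable to `(1+|ξ|²)^η`.
  obtain ⟨C, hC, h⟩ := hassoc.exists_fourier_decay hf hU hfU k (mul_pos two_pos hη)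
  refine ⟨C * 2 ^ η + 1, by positivity, fun ξ => ?_⟩
  set R : ℝ := 1 + ‖ξ‖ with hR
  set B : ℝ := 1 + ‖ξ‖ ^ 2 with hB
  have hξ := norm_nonneg ξ
  have hR0 : 0 < R := by positivity
  have hB0 : 0 < B := by positivity
  have hBR : B ≤ R ^ 2 := by rw [hR, hB]; nlinarith
  have hRB : R ^ 2 ≤ 2 * B := by rw [hR, hB]; nlinarith [sq_nonneg (‖ξ‖ - 1)]
  have h1 : B ^ ((k : ℝ) / 2) ≤ R ^ k := by
    calc B ^ ((k : ℝ) / 2) ≤ (R ^ 2) ^ ((k : ℝ) / 2) :=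
          Real.rpow_le_rpow hB0.le hBR (by positivity)
      _ = R ^ k := by
          rw [← Real.rpow_natCast R 2, ← Real.rpow_mul hR0.le, ← Real.rpow_natCast]
          congr 1
          push_cast
          ring
  have h2 : R ^ (2 * η) ≤ 2 ^ η * B ^ η := by
    rw [Real.rpow_mul hR0.le, ← Real.mul_rpow zero_le_two hB0.le]
    refine Real.rpow_le_rpow (by positivity) ?_ hη.le
    exact_mod_cast hRB
  have h3 : B ^ ((k : ℝ) / 2) * ‖T.fourier ξ‖ ≤ C * 2 ^ η * B ^ η := by
    rw [mul_assoc]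
    refine (mul_le_mul_of_nonneg_right h1 (norm_nonneg _)).trans ((h ξ).trans ?_)
    gcongr
  have h4 : B ^ (-(k : ℝ) / 2 + η) = B ^ η / B ^ ((k : ℝ) / 2) := by
    rw [← Real.rpow_sub hB0]
    ring_nf
  have hBk : 0 < B ^ ((k : ℝ) / 2) := Real.rpow_pos_of_pos hB0 _
  rw [h4, ← mul_div_assoc, le_div_iff₀ hBk, mul_comm]
  refine h3.trans ?_
  have := Real.rpow_pos_of_pos hB0 η
  gcongr
  linarith

/-! ### Littlewood-Paley blocks -/

/-- The phase `(x - z)·y/ε` splits, which exhibits the kernel as a superposition in `z` of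
characters of frequency `-y/ε`. -/
theorem reflectAt_dilate_invFourier_apply {ε : ℝ} (hε : 0 < ε) (G : 𝓢(Euc d, ℂ)) (x z : Euc d) :
    reflectAt (dilate ε hε (invFourier G)) x z =
      ((ε ^ d * (2 * Real.pi) ^ d)⁻¹ : ℝ) •
        ∫ y, expChar (-(ε⁻¹ • y)) z * (expChar (ε⁻¹ • x) y * G y) := by
  rw [reflectAt_apply, dilate_apply, invFourier_apply, smul_smul, mul_inv]
  congr 1
  refine integral_congr_ae (Eventually.of_forall fun y => ?_)
  have h : (inner ℝ (ε⁻¹ • (x - z)) y : ℝ) = inner ℝ (-(ε⁻¹ • y)) z + inner ℝ (ε⁻¹ • x) y := by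
    rw [smul_sub, inner_sub_left, inner_neg_left, real_inner_smul_left, real_inner_smul_left,
      real_inner_smul_left, real_inner_comm y z]
    ring
  simp only [h, expChar]
  rw [← mul_assoc, ← Complex.exp_add, Complex.ofReal_add, mul_add]

theorem continuous_expChar_uncurry : Continuous fun p : Euc d × Euc d => expChar p.1 p.2 :=
  Complex.continuous_exp.comp (continuous_const.mul
    (Complex.continuous_ofReal.comp (continuous_fst.inner continuous_snd)))

/-- Fubini applies because the characters are unimodular and both `g`, extended by zero, and `G` are
integrable. -/
theorem setIntegral_mul_reflectAt_eq {g : ESpace ⊤ Ω} (hU : CompactlyIn U Ω)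
    (hs : suppIn Ω g ⊆ U) {ε : ℝ} (hε : 0 < ε) (G : 𝓢(Euc d, ℂ)) (x : Euc d) :
    ∫ z in (Ω : Set (Euc d)), g z * reflectAt (dilate ε hε (invFourier G)) x z =
      ((ε ^ d * (2 * Real.pi) ^ d)⁻¹ : ℝ) •
        ∫ y, expChar (ε⁻¹ • x) y * G y *
          ∫ z in (Ω : Set (Euc d)), g z * expChar (-(ε⁻¹ • y)) z := by
  set F := (Ω : Set (Euc d)).indicator g with hF
  have hFc : Continuous F := (contDiff_indicator hU hs).continuous
  have hFi : Integrable F := hFc.integrable_of_hasCompactSupport (hasCompactSupport_indicator hU hs)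
  have hint : Integrable (Function.uncurry fun z y =>
      F z * (expChar (-(ε⁻¹ • y)) z * (expChar (ε⁻¹ • x) y * G y)))
      ((volume : Measure (Euc d)).prod (volume : Measure (Euc d))) := by
    have hc : Continuous fun q : Euc d × Euc d =>
        F q.1 * (expChar (-(ε⁻¹ • q.2)) q.1 * (expChar (ε⁻¹ • x) q.2 * G q.2)) := by
      have h1 : Continuous fun q : Euc d × Euc d => expChar (-(ε⁻¹ • q.2)) q.1 :=
        continuous_expChar_uncurry.comp
          ((continuous_snd.const_smul ε⁻¹).neg.prodMk continuous_fst)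
      have h2 : Continuous fun y : Euc d => expChar (ε⁻¹ • x) y :=
        (contDiff_expChar' _).continuous
      exact (hFc.comp continuous_fst).mul
        (h1.mul ((h2.comp continuous_snd).mul (G.continuous.comp continuous_snd)))
    have hG : Integrable (fun y => G y) := G.integrable
    refine (hFi.mul_prod hG).mono hc.aestronglyMeasurable
      (Eventually.of_forall fun q => le_of_eq ?_)
    simp only [Function.uncurry, norm_mul, norm_expChar, one_mul]
  rw [setIntegral_mul_eq]
  simp only [setIntegral_mul_eq, ← hF, reflectAt_dilate_invFourier_apply, mul_smul_comm,
    integral_smul]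
  congr 1
  simp only [← integral_const_mul]
  rw [integral_integral_swap hint]
  refine integral_congr_ae (Eventually.of_forall fun y => ?_)
  refine integral_congr_ae (Eventually.of_forall fun z => ?_)
  simp only
  ring

/-- The block is computed for `f` at the dyadic parameters and the limit is taken with the scale `ε`
fixed. On the support of `G` the frequencies are at most `1/ε`, so the error `C · dyadic n ·
(1+1/ε)^r` tends to zero. -/
theorem RapidlyAssociated.norm_conv_le {T : EDual ⊤ Ω} {f : Net Ω}
    (hassoc : RapidlyAssociated T f) (hU : CompactlyIn U Ω)
    (hfU : ∀ ε ∈ Ioo (0 : ℝ) 1, suppIn Ω (f ε) ⊆ U) {ε : ℝ} (hε : 0 < ε) (G : 𝓢(Euc d, ℂ))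
    (hG : ∀ y, G y ≠ 0 → ‖y‖ ≤ 1) {D : ℝ}
    (hD : ∀ y, G y ≠ 0 → ‖T.fourier (-(ε⁻¹ • y))‖ ≤ D) (x : Euc d) :
    ‖conv T.toTempered (dilate ε hε (invFourier G)) x‖ ≤
      (ε ^ d * (2 * Real.pi) ^ d)⁻¹ * (D * ∫ y, ‖G y‖) := by
  obtain ⟨r, hr⟩ := hassoc.exists_fourier_bound hU hfU
  obtain ⟨C, hC, hT⟩ := hr 1 one_pos
  set h := reflectAt (dilate ε hε (invFourier G)) x with hh
  have hlim : Tendsto (fun n => ‖∫ z in (Ω : Set (Euc d)), f (dyadic n) z * h z‖) atTop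
      (𝓝 ‖conv T.toTempered (dilate ε hε (invFourier G)) x‖) :=
    (hassoc.tendsto (ESpace.ofContDiff Ω h h.smooth')).norm
  have hdy : Tendsto dyadic atTop (𝓝 0) := tendsto_dyadic.mono_right nhdsWithin_le_nhds
  have hlim' : Tendsto (fun n => (ε ^ d * (2 * Real.pi) ^ d)⁻¹ *
      ((D + C * dyadic n * (1 + ε⁻¹) ^ r) * ∫ y, ‖G y‖)) atTop
      (𝓝 ((ε ^ d * (2 * Real.pi) ^ d)⁻¹ *
        ((D + C * 0 * (1 + ε⁻¹) ^ r) * ∫ y, ‖G y‖))) :=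
    ((((hdy.const_mul C).mul_const _).const_add D).mul_const _).const_mul _
  rw [mul_zero, zero_mul, add_zero] at hlim'
  refine le_of_tendsto_of_tendsto' hlim hlim' fun n => ?_
  rw [hh, setIntegral_mul_reflectAt_eq hU (hfU _ (dyadic_mem n)), norm_smul,
    Real.norm_of_nonneg (by positivity)]
  refine mul_le_mul_of_nonneg_left ?_ (by positivity)
  rw [← integral_const_mul]
  refine norm_integral_le_of_norm_le ((G.integrable (μ := volume)).norm.const_mul _)
    (Eventually.of_forall fun y => ?_)
  rw [norm_mul, norm_mul, norm_expChar, one_mul, mul_comm]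
  rcases eq_or_ne (G y) 0 with hy | hy
  · simp [hy]
  refine mul_le_mul_of_nonneg_right ?_ (norm_nonneg _)
  refine (norm_le_norm_add_norm_sub (T.fourier (-(ε⁻¹ • y))) _).trans
    (add_le_add (hD y hy) ((hT n _).trans ?_))
  rw [Real.rpow_one, norm_neg, norm_smul, Real.norm_of_nonneg (inv_nonneg.2 hε.le)]
  have := (dyadic_pos n).le
  gcongr
  exact mul_le_of_le_one_right (inv_nonneg.2 hε.le) (hG y hy)

theorem dilate_one (f : 𝓢(Euc d, ℂ)) : dilate 1 one_pos f = f := by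
  ext x
  simp [dilate_apply]

/-! ### Frequency localization and the Zygmund estimate -/

namespace LPCutoff

variable (θ : LPCutoff d)

theorem norm_le_of_ne_zero {y : Euc d} (h : θ.toFun y ≠ 0) : ‖y‖ ≤ 1 :=
  mem_closedBall_zero_iff.1 (θ.supp (subset_tsupport _ h))

/-- `θ` is locally constant on `|y| < 1/2`, so its gradient lives on an annulus. -/
theorem norm_mem_of_zeta_ne_zero {y : Euc d} (h : θ.zeta y ≠ 0) : ‖y‖ ∈ Icc (1 / 2 : ℝ) 1 := by
  have h1 : fderiv ℝ θ.toFun y ≠ 0 := by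
    intro h0
    exact h (by simp [zeta, h0])
  refine ⟨?_, mem_closedBall_zero_iff.1 (θ.supp (support_fderiv_subset ℝ h1))⟩
  by_contra! hy
  refine h1 ?_
  have h2 : θ.toFun =ᶠ[𝓝 y] fun _ => 1 := by
    filter_upwards [(isOpen_lt continuous_norm continuous_const).mem_nhds hy] with z hz
    exact θ.eq_one z (le_of_lt hz)
  rw [h2.fderiv_eq, fderiv_const_apply]

end LPCutoff

/-- On the annulus `1 + (t/ε)²` is within a factor `4` of `ε^{-2}`, from above and from below; `|p|`
covers both signs of the exponent. -/
theorem one_add_sq_rpow_le {ε t p : ℝ} (hε : 0 < ε) (hε1 : ε < 1) (ht : t ∈ Icc (1 / 2 : ℝ) 1) :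
    (1 + (ε⁻¹ * t) ^ 2) ^ p ≤ 4 ^ |p| * ε ^ (-(2 * p)) := by
  have h1 : 1 < ε⁻¹ := (one_lt_inv₀ hε).2 hε1
  have h2 : ε ^ (-(2 * p)) = (ε⁻¹ ^ 2) ^ p := by
    rw [← Real.rpow_natCast, ← Real.rpow_mul (by positivity), Real.inv_rpow hε.le,
      ← Real.rpow_neg hε.le]
    norm_num
  have hs : 1 < ε⁻¹ ^ 2 := one_lt_pow₀ h1 two_ne_zero
  have ht0 : 1 / 4 ≤ t ^ 2 := by nlinarith [ht.1]
  have ht1 : t ^ 2 ≤ 1 := by nlinarith [ht.1, ht.2]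
  rw [h2, mul_pow]
  rcases le_total 0 p with hp | hp
  · rw [abs_of_nonneg hp, ← Real.mul_rpow (by norm_num) (by positivity)]
    exact Real.rpow_le_rpow (by positivity) (by nlinarith) hp
  · rw [abs_of_nonpos hp, Real.rpow_neg (by norm_num), ← Real.inv_rpow (by norm_num),
      ← Real.mul_rpow (by norm_num) (by positivity)]
    exact Real.rpow_le_rpow_of_nonpos (by positivity) (by nlinarith) hp

/-- Decay of the Fourier transform of a distribution rapidly associated to a net gives Zygmund
regularity, with a loss of `d` derivatives. -/
theorem RapidlyAssociated.mem_zygmund {T : EDual ⊤ Ω} {f : Net Ω}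
    (hassoc : RapidlyAssociated T f) (hU : CompactlyIn U Ω)
    (hfU : ∀ ε ∈ Ioo (0 : ℝ) 1, suppIn Ω (f ε) ⊆ U) {C p : ℝ} (hC : 0 ≤ C)
    (h : ∀ ξ : Euc d, ‖T.fourier ξ‖ ≤ C * (1 + ‖ξ‖ ^ 2) ^ p) (θ : LPCutoff d) :
    T.toTempered ∈ Zygmund θ (-(2 * p) - d) := by
  refine ENNReal.add_lt_top.2 ⟨?_, ?_⟩
  · have hD : ∀ y : Euc d, (θ.toFun y : ℂ) ≠ 0 →
        ‖T.fourier (-((1 : ℝ)⁻¹ • y))‖ ≤ C * 2 ^ |p| := by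
      intro y hy
      have hy1 := θ.norm_le_of_ne_zero (Complex.ofReal_ne_zero.1 hy)
      refine (h _).trans (mul_le_mul_of_nonneg_left ?_ hC)
      rw [inv_one, one_smul, norm_neg]
      have h1 : 1 ≤ 1 + ‖y‖ ^ 2 := le_add_of_nonneg_right (by positivity)
      refine (Real.rpow_le_rpow_of_exponent_le h1 (le_abs_self p)).trans ?_
      refine Real.rpow_le_rpow (by positivity) ?_ (abs_nonneg p)
      nlinarith [norm_nonneg y]
    have hb := hassoc.norm_conv_le hU hfU one_pos
      ((θ.hasCompactSupport.comp_left (g := fun t : ℝ => (t : ℂ))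
        Complex.ofReal_zero).toSchwartzMap (Complex.ofRealCLM.contDiff.comp θ.smooth))
      (fun y hy => θ.norm_le_of_ne_zero (Complex.ofReal_ne_zero.1 hy)) hD
    rw [eLpNorm_exponent_top]
    simp only [dilate_one] at hb
    exact eLpNormEssSup_lt_top_of_ae_bound (Eventually.of_forall hb)
  · set G := (θ.zeta_hasCompactSupport.comp_left (g := fun t : ℝ => (t : ℂ))
      Complex.ofReal_zero).toSchwartzMap (Complex.ofRealCLM.contDiff.comp θ.zeta_smooth) with hG
    have hG' : ∀ y, G y ≠ 0 → ‖y‖ ∈ Icc (1 / 2 : ℝ) 1 := fun y hy =>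
      θ.norm_mem_of_zeta_ne_zero (Complex.ofReal_ne_zero.1 hy)
    refine (iSup_le fun ε => iSup_le fun hε => iSup_le fun hε1 => ?_ : _ ≤ ENNReal.ofReal
      (((2 * Real.pi) ^ d)⁻¹ * (C * 4 ^ |p| * ∫ y, ‖G y‖))).trans_lt ENNReal.ofReal_lt_top
    have hD : ∀ y, G y ≠ 0 → ‖T.fourier (-(ε⁻¹ • y))‖ ≤ C * (4 ^ |p| * ε ^ (-(2 * p))) := by
      intro y hy
      refine (h _).trans (mul_le_mul_of_nonneg_left ?_ hC)
      rw [norm_neg, norm_smul, Real.norm_of_nonneg (inv_nonneg.2 hε.le)]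
      exact one_add_sq_rpow_le hε hε1 (hG' y hy)
    have hb := hassoc.norm_conv_le hU hfU hε G (fun y hy => (hG' y hy).2) hD
    have hεr : 0 ≤ ε ^ (-(-(2 * p) - d)) := Real.rpow_nonneg hε.le _
    rw [eLpNorm_exponent_top]
    refine (mul_le_mul_right (eLpNormEssSup_le_of_ae_bound (Eventually.of_forall hb)) _).trans ?_
    rw [← ENNReal.ofReal_mul hεr]
    refine ENNReal.ofReal_le_ofReal (le_of_eq ?_)
    -- The power `ε^d` left over cancels the `ε^{-d}` of the dilated kernel; this balance fixes the
    -- Zygmund exponent `-2p - d`.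
    have h1 : ε ^ (-(-(2 * p) - d)) * ε ^ (-(2 * p)) = ε ^ d := by
      rw [← Real.rpow_add hε, ← Real.rpow_natCast]
      congr 1
      ring
    rw [mul_inv]
    calc ε ^ (-(-(2 * p) - d)) * ((ε ^ d)⁻¹ * ((2 * Real.pi) ^ d)⁻¹ *
          (C * (4 ^ |p| * ε ^ (-(2 * p))) * ∫ y, ‖G y‖))
        = (ε ^ (-(-(2 * p) - d)) * ε ^ (-(2 * p))) * (ε ^ d)⁻¹ *
          (((2 * Real.pi) ^ d)⁻¹ * (C * 4 ^ |p| * ∫ y, ‖G y‖)) := by ring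
      _ = _ := by rw [h1, mul_inv_cancel₀ (pow_ne_zero d hε.ne'), one_mul]

end RegularityGF

end

theorem mainTheorem2 (d k : ℕ) (Ω : TopologicalSpace.Opens (RegularityGF.Euc d))
    (T : RegularityGF.EDual ⊤ Ω) (f : RegularityGF.Net Ω)
    (s₁ : EReal) (hs₁ : 0 < s₁) (hf : f ∈ RegularityGF.EM Ω k s₁)
    (U : Set (RegularityGF.Euc d)) (hU : RegularityGF.CompactlyIn U Ω)
    (hTU : T.supp ⊆ U)
    (hfU : ∀ ε ∈ Set.Ioo (0 : ℝ) 1, RegularityGF.suppIn Ω (f ε) ⊆ U)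
    (hassoc : RegularityGF.RapidlyAssociated T f) :
    (∀ η : ℝ, 0 < η → ∃ C : ℝ, 0 < C ∧ ∀ ξ : RegularityGF.Euc d,
      ‖T.fourier ξ‖ ≤ C * (1 + ‖ξ‖ ^ 2) ^ (-(k : ℝ) / 2 + η)) ∧
    (∀ η : ℝ, 0 < η → ∀ θ : RegularityGF.LPCutoff d,
      T.toTempered ∈ RegularityGF.Zygmund θ ((k : ℝ) - (d : ℝ) - η)) := by
  have hmod : RegularityGF.IsModerate f := by
    simp only [RegularityGF.EM, Set.mem_iUnion] at hf
    obtain ⟨_, _, _, _, h⟩ := hf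
    exact h.1
  have hF := fun (η : ℝ) (hη : 0 < η) =>
    RegularityGF.exists_norm_fourier_le hassoc hmod hU hfU k hη
  refine ⟨hF, fun η hη θ => ?_⟩
  -- With `p = -k/2 + η/2`, the exponent `-2p - d` is exactly `k - d - η`.
  obtain ⟨C, hC, h⟩ := hF (η / 2) (half_pos hη)
  have := hassoc.mem_zygmund hU hfU hC.le h θ
  rwa [show -(2 * (-(k : ℝ) / 2 + η / 2)) - d = (k : ℝ) - d - η by ring] at this
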